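/- Let $\mathbb{D}$ be the open and $\Delta$ the closed unit disc in $\mathbb{C}$, let $\Gamma=\{(z+w,zw): z,w\in\Delta\}$ be the closed symmetrised bidisc, let $\mathrm{Hol}(\mathbb{D},\Gamma)$ be the set of holomorphic maps $\mathbb{D}\to\mathbb{C}^2$ with values in $\Gamma$, and put $\Phi(z,s,p)=\dfrac{2zp-s}{2-zs}$ for $zs\neq 2$. For an integer $\nu\ge 0$ let $\mathcal{B}l_\nu$ be the set of finite Blaschke products of degree at most $\nu$ (so $\mathcal{B}l_0$ consists of the unimodular constants). For $\nu\ge0$ and $k\ge1$ let $\mathcal{E}_{\nu k}$ be the set of rational $h=(s,p)\in\mathrm{Hol}(\mathbb{D},\Gamma)$ for which there exists $m\in\mathcal{B}l_\nu$ such that $\Phi\circ(m,h)=\dfrac{2mp-s}{2-ms}\in\mathcal{B}l_{k-1}$. For distinct points $\lambda_1,\dots,\lambda_n\in\mathbb{D}$ and $w_1,\dots,w_n\in\mathbb{C}$, the Nevanlinna--Pick data $\lambda_j\mapsto w_j$ are *solvable* if some holomorphic $f:\mathbb{D}\to\Delta$ satisfies $f(\lambda_j)=w_j$ for all $j$, and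 *extremally solvable* if they are solvable but no holomorphic $f$ on $\mathbb{D}$ with $\sup_{\mathbb{D}}|f|<1$ satisfies $f(\lambda_j)=w_j$ for all $j$. $\Gamma$-interpolation data $\lambda_j\mapsto z_j$ $(1\le j\le n)$ consist of distinct points $\lambda_j\in\mathbb{D}$ and points $z_j\in\Gamma$. They satisfy the condition $\mathcal{C}_\nu(\lambda,z)$ if, for every $\upsilon\in\mathcal{B}l_\nu$ (for which the values below are defined), the Nevanlinna--Pick data $\lambda_j\mapsto\Phi(\upsilon(\lambda_j),z_j)$ are solvable; they satisfy $\mathcal{C}_\nu(\lambda,z)$ *extremally* if they satisfy $\mathcal{C}_\nu(\lambda,z)$ and there is $m\in\mathcal{B}l_\nu$ for which the Nevanlinna--Pick data $\lambda_j\mapsto\Phi(m(\lambda_j),z_j)$ are defined and extremally solvable. **Proposition.** Let $\nu\ge0$ and $n\ge1$ be integers. If $h\in\mathcal{E}_{\nu n}$ then, for any choice of distinct points $\lambda_1,\dots,\lambda_n\in\mathbb{D}$, the $\Gamma$-interpolation data $\lambda_j\mapsto z_j=h(\lambda_j)$, $1\le j\le n$, satisfy $\mathcal{C}_\nu(\lambda,z)$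 extremally. -/

import Mathlib

noncomputable section

namespace SymBidisc

/-- The open unit disc in the complex plane. -/
def disc : Set ℂ := Metric.ball 0 1

/-- The closed symmetrised bidisc: all `(z + w, z * w)` with `|z| ≤ 1` and `|w| ≤ 1`. -/
def Gam : Set (ℂ × ℂ) :=
  {x | ∃ z w : ℂ, ‖z‖ ≤ 1 ∧ ‖w‖ ≤ 1 ∧ x = (z + w, z * w)}

/-- The holomorphic maps from the open unit disc to the closed symmetrised bidisc. A map on the
disc is represented by a total function, of which only the values on the disc matter. -/
def HolGam : Set (ℂ → ℂ × ℂ) :=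
  {h | DifferentiableOn ℂ h disc ∧ Set.MapsTo h disc Gam}

/-- `Bl n`: the finite Blaschke products of degree at most `n` (as functions on the disc). The
elements of `Bl 0` are the unimodular constants. -/
def Bl (n : ℕ) : Set (ℂ → ℂ) :=
  {f | ∃ d : ℕ, d ≤ n ∧ ∃ (c : ℂ) (a : Fin d → ℂ), ‖c‖ = 1 ∧ (∀ i, a i ∈ disc) ∧
    ∀ z ∈ disc, f z = c * ∏ i, (z - a i) / (1 - (starRingEnd ℂ) (a i) * z)}

/-- A function on the disc that is the quotient of two polynomials, with the denominator free of
zeros in the disc. -/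
def IsRationalOnDisc (f : ℂ → ℂ) : Prop :=
  ∃ P Q : Polynomial ℂ, ∀ z ∈ disc, Q.eval z ≠ 0 ∧ f z = P.eval z / Q.eval z

/-- `Φ(z, s, p) = (2 z p - s) / (2 - z s)`, which is meaningful where `z s ≠ 2`. -/
def Phi (z : ℂ) (x : ℂ × ℂ) : ℂ := (2 * z * x.2 - x.1) / (2 - z * x.1)

/-- The class `E_{ν k}` (for `k ≥ 1`): the rational `h = (s, p)` in `HolGam` such that
`(2 m p - s) / (2 - m s)` is in `Bl (k - 1)` for some `m` in `Bl ν`. -/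
def E (ν k : ℕ) : Set (ℂ → ℂ × ℂ) :=
  {h | h ∈ HolGam ∧ IsRationalOnDisc (fun z => (h z).1) ∧ IsRationalOnDisc (fun z => (h z).2) ∧
    ∃ m ∈ Bl ν, (∀ z ∈ disc, m z * (h z).1 ≠ 2) ∧ (fun z => Phi (m z) (h z)) ∈ Bl (k - 1)}

/-- Interpolation data `l j ↦ z j` for the closed symmetrised bidisc: distinct nodes in the disc
and target points in `Gam`. -/
def IsGamData {n : ℕ} (l : Fin n → ℂ) (z : Fin n → ℂ × ℂ) : Prop :=
  Function.Injective l ∧ (∀ j, l j ∈ disc) ∧ ∀ j, z j ∈ Gam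

/-- The Nevanlinna-Pick data `l j ↦ w j` are solvable: a holomorphic map from the disc to the
closed disc interpolates them. -/
def NPSolvable {n : ℕ} (l w : Fin n → ℂ) : Prop :=
  ∃ f : ℂ → ℂ, DifferentiableOn ℂ f disc ∧ (∀ x ∈ disc, ‖f x‖ ≤ 1) ∧ ∀ j, f (l j) = w j

/-- The Nevanlinna-Pick data `l j ↦ w j` are extremally solvable: they are solvable, but not by a
holomorphic function on the disc of supremum norm less than `1`. -/
def NPExtremallySolvable {n : ℕ} (l w : Fin n → ℂ) : Prop :=
  NPSolvable l w ∧
    ¬ ∃ (f : ℂ → ℂ) (r : ℝ), r < 1 ∧ DifferentiableOn ℂ f disc ∧ (∀ x ∈ disc, ‖f x‖ ≤ r) ∧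
      ∀ j, f (l j) = w j

/-- All the values `Φ(υ(l j), z j)` are defined. -/
def PhiDefined {n : ℕ} (υ : ℂ → ℂ) (l : Fin n → ℂ) (z : Fin n → ℂ × ℂ) : Prop :=
  ∀ j, υ (l j) * (z j).1 ≠ 2

/-- The condition `C_ν(l, z)`: for every Blaschke product `υ` of degree at most `ν`, the
Nevanlinna-Pick data `l j ↦ Φ(υ(l j), z j)` are solvable. (If `z j` is in `Gam`, a value
`Φ(υ(l j), z j)` is undefined only if `υ` is a unimodular constant `ω` and
`z j = (2 ω⁻¹, ω⁻²)`.) -/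
def CondC {n : ℕ} (ν : ℕ) (l : Fin n → ℂ) (z : Fin n → ℂ × ℂ) : Prop :=
  ∀ υ ∈ Bl ν, PhiDefined υ l z → NPSolvable l (fun j => Phi (υ (l j)) (z j))

/-- The data `l j ↦ z j` satisfy `C_ν(l, z)` extremally: the condition holds and, for some
Blaschke product `m` of degree at most `ν`, the Nevanlinna-Pick data `l j ↦ Φ(m(l j), z j)` are
extremally solvable. -/
def CondCExtremally {n : ℕ} (ν : ℕ) (l : Fin n → ℂ) (z : Fin n → ℂ × ℂ) : Prop :=
  CondC ν l z ∧
    ∃ m ∈ Bl ν, PhiDefined m l z ∧ NPExtremallySolvable l (fun j => Phi (m (l j)) (z j))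

end SymBidisc

end

/-!
Let `h = (s, p)` be in `E ν n`.

*Solvability.* If `|z| ≤ 1` and `(s, p) ∈ Γ` then `|2 z p - s| ≤ |2 - z s|`
(`norm_numerator_le`), so `Φ ∘ (υ, h)` maps the disc into the closed disc wherever it is defined.
As `|υ s| ≤ 2`, the maximum principle shows that `υ s` takes the value `2` either nowhere or
everywhere in the disc (`mul_fst_ne_two`); the latter is excluded as soon as the data are defined
at one node. Hence `Φ ∘ (υ, h)` solves the Nevanlinna-Pick problem.

*Extremality.* Let `m` be the Blaschke product for which `B = Φ ∘ (m, h)` is a Blaschke product of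
degree `d < n`. It must be shown that no holomorphic `g` with `|g| ≤ r < 1` agrees with `B` at `n`
points `λ_j` (`not_interpolate_blaschke`). Write `B = c P / Q` with `P = ∏ (z - a_i)` and
`Q = ∏ (1 - conj a_i z)`, and put `L = ∏ (z - λ_j)` and `M = ∏ (1 - conj λ_j z)`. Then
`c P - Q g = L k` with `k` holomorphic, and

  `F = z ^ (n - d) Q k / (c M) = z ^ (n - d) Q (P - Q g / c) / (L M)`

is holomorphic in the disc and vanishes at `0`. On the unit circle `P = z ^ d conj Q` and
`L = z ^ n conj M`, so `z ^ (n - d) Q P / (L M)` is there the positive number `|Q|² / |M|²`, while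
the coefficient of `g` has modulus `|Q|² / |M|²`. By continuity of these coefficients and
`|g| ≤ r < 1`, `Re F > 0` on all circles close to the unit circle, and the maximum principle for
`exp (-F)` gives `Re F(0) > 0`, a contradiction. This replaces an appeal to Rouché's theorem, and
needs no boundary values of `g`.
-/

open SymBidisc ComplexConjugate

/-! ### The inequality for `Φ` on the closed symmetrised bidisc -/

theorem norm_fst_le_two {x : ℂ × ℂ} (hx : x ∈ Gam) : ‖x.1‖ ≤ 2 := by
  obtain ⟨a, b, ha, hb, rfl⟩ := hx
  exact (norm_add_le a b).trans (by linarith)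

/-- A point `(s, p)` of `Γ` satisfies `|s - p conj s| ≤ 1 - |p|²`. -/
theorem norm_sub_mul_conj_le {x : ℂ × ℂ} (hx : x ∈ Gam) :
    ‖x.1 - x.2 * conj x.1‖ ≤ 1 - ‖x.2‖ ^ 2 := by
  obtain ⟨a, b, ha, hb, rfl⟩ := hx
  have key : a + b - a * b * conj (a + b)
      = a * ((1 - ‖b‖ ^ 2 : ℝ) : ℂ) + b * ((1 - ‖a‖ ^ 2 : ℝ) : ℂ) := by
    push_cast
    rw [← Complex.mul_conj', ← Complex.mul_conj', map_add]
    ring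
  have h0a := norm_nonneg a
  have h0b := norm_nonneg b
  have ha2 : 0 ≤ 1 - ‖a‖ ^ 2 := by nlinarith
  have hb2 : 0 ≤ 1 - ‖b‖ ^ 2 := by nlinarith
  simp only
  rw [key]
  refine (norm_add_le _ _).trans ?_
  rw [norm_mul, norm_mul, Complex.norm_real, Complex.norm_real, Real.norm_of_nonneg ha2,
    Real.norm_of_nonneg hb2, norm_mul]
  have h1 : 0 ≤ 1 - ‖a‖ * ‖b‖ := by nlinarith
  have h2 : 0 ≤ (1 - ‖a‖) * (1 - ‖b‖) :=
    mul_nonneg (by linarith) (by linarith)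
  -- `α (1 - β²) + β (1 - α²) = (α + β) (1 - α β)` and `α + β ≤ 1 + α β`
  nlinarith [mul_nonneg h1 h2]

/-- A point `(s, p)` of `Γ` satisfies `|s|² ≤ 2 (1 + |p|²)`. -/
theorem norm_fst_sq_le {x : ℂ × ℂ} (hx : x ∈ Gam) : ‖x.1‖ ^ 2 ≤ 2 * (1 + ‖x.2‖ ^ 2) := by
  obtain ⟨a, b, ha, hb, rfl⟩ := hx
  have h0a := norm_nonneg a
  have h0b := norm_nonneg b
  have h1 : ‖a + b‖ ^ 2 ≤ (‖a‖ + ‖b‖) ^ 2 := by gcongr; exact norm_add_le a b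
  have h2 : 0 ≤ (1 - ‖a‖ ^ 2) * (1 - ‖b‖ ^ 2) := mul_nonneg (by nlinarith) (by nlinarith)
  simp only [norm_mul]
  nlinarith [sq_nonneg (‖a‖ - ‖b‖)]

/-- The inequality `|Φ(z, s, p)| ≤ 1` for `|z| ≤ 1` and `(s, p) ∈ Γ`, cleared of denominators. -/
theorem norm_numerator_le {z : ℂ} (hz : ‖z‖ ≤ 1) {x : ℂ × ℂ} (hx : x ∈ Gam) :
    ‖2 * z * x.2 - x.1‖ ≤ ‖2 - z * x.1‖ := by
  have h1 := norm_sub_mul_conj_le hx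
  have h2 := norm_fst_sq_le hx
  have h3 := norm_fst_le_two hx
  obtain ⟨s, p⟩ := x
  simp only at h1 h2 h3 ⊢
  have key : ‖2 - z * s‖ ^ 2 - ‖2 * z * p - s‖ ^ 2
      = 4 * (1 - ‖z‖ ^ 2 * ‖p‖ ^ 2) - (1 - ‖z‖ ^ 2) * ‖s‖ ^ 2
        - 4 * (z * (s - p * conj s)).re := by
    simp only [← Complex.normSq_eq_norm_sq, Complex.normSq_apply, Complex.sub_re, Complex.sub_im,
      Complex.mul_re, Complex.mul_im, Complex.conj_re, Complex.conj_im, Complex.re_ofNat,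
      Complex.im_ofNat]
    ring
  have h4 : (z * (s - p * conj s)).re ≤ ‖z‖ * (1 - ‖p‖ ^ 2) := by
    refine (Complex.re_le_norm _).trans ?_
    rw [norm_mul]
    gcongr
  have h0 := norm_nonneg z
  have h5 : ‖s‖ ^ 2 ≤ 4 := by nlinarith [norm_nonneg s]
  -- affine in `|z|`, so it suffices to check the endpoints `0` and `1`
  have h6 : 0 ≤ 4 * (1 + ‖z‖ * ‖p‖ ^ 2) - (1 + ‖z‖) * ‖s‖ ^ 2 := by
    nlinarith [mul_nonneg h0 (sub_nonneg.2 h2),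
      mul_nonneg (sub_nonneg.2 hz) (sub_nonneg.2 h5)]
  have h7 := mul_nonneg (sub_nonneg.2 hz) h6
  refine le_of_sq_le_sq ?_ (norm_nonneg _)
  nlinarith

theorem norm_Phi_le_one {z : ℂ} (hz : ‖z‖ ≤ 1) {x : ℂ × ℂ} (hx : x ∈ Gam) : ‖Phi z x‖ ≤ 1 := by
  rw [Phi, norm_div]
  exact div_le_one_of_le₀ (norm_numerator_le hz hx) (norm_nonneg _)

/-! ### Blaschke products -/

theorem mem_disc_iff {z : ℂ} : z ∈ disc ↔ ‖z‖ < 1 := mem_ball_zero_iff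

theorem isOpen_disc : IsOpen disc := Metric.isOpen_ball

theorem one_sub_conj_mul_ne_zero {a z : ℂ} (ha : a ∈ disc) (hz : ‖z‖ ≤ 1) :
    1 - conj a * z ≠ 0 := by
  rw [mem_disc_iff] at ha
  intro h
  have h1 : ‖conj a * z‖ = 1 := by rw [← sub_eq_zero.1 h, norm_one]
  rw [norm_mul, Complex.norm_conj] at h1
  nlinarith [norm_nonneg a, norm_nonneg z]

theorem norm_sub_le_norm_one_sub_conj_mul {a z : ℂ} (ha : ‖a‖ ≤ 1) (hz : ‖z‖ ≤ 1) :
    ‖z - a‖ ≤ ‖1 - conj a * z‖ := by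
  have key : ‖1 - conj a * z‖ ^ 2 - ‖z - a‖ ^ 2 = (1 - ‖a‖ ^ 2) * (1 - ‖z‖ ^ 2) := by
    simp only [← Complex.normSq_eq_norm_sq, Complex.normSq_apply, Complex.sub_re, Complex.sub_im,
      Complex.mul_re, Complex.mul_im, Complex.conj_re, Complex.conj_im, Complex.one_re,
      Complex.one_im]
    ring
  have h : 0 ≤ (1 - ‖a‖ ^ 2) * (1 - ‖z‖ ^ 2) :=
    mul_nonneg (by nlinarith [norm_nonneg a]) (by nlinarith [norm_nonneg z])
  exact le_of_sq_le_sq (by linarith) (norm_nonneg _)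

theorem differentiableOn_of_mem_Bl {ν : ℕ} {f : ℂ → ℂ} (hf : f ∈ Bl ν) :
    DifferentiableOn ℂ f disc := by
  obtain ⟨d, -, c, a, -, ha, h⟩ := hf
  refine DifferentiableOn.congr ?_ h
  refine (differentiableOn_const c).mul (DifferentiableOn.fun_finsetProd fun i _ => ?_)
  exact DifferentiableOn.div (by fun_prop) (by fun_prop)
    fun z hz => one_sub_conj_mul_ne_zero (ha i) (mem_disc_iff.1 hz).le

theorem norm_le_one_of_mem_Bl {ν : ℕ} {f : ℂ → ℂ} (hf : f ∈ Bl ν) {z : ℂ} (hz : z ∈ disc) :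
    ‖f z‖ ≤ 1 := by
  obtain ⟨d, -, c, a, hc, ha, h⟩ := hf
  rw [h z hz, norm_mul, hc, one_mul, norm_prod]
  refine Finset.prod_le_one (fun _ _ => norm_nonneg _) fun i _ => ?_
  rw [norm_div]
  exact div_le_one_of_le₀ (norm_sub_le_norm_one_sub_conj_mul (mem_disc_iff.1 (ha i)).le
    (mem_disc_iff.1 hz).le) (norm_nonneg _)

/-! ### Solvability of the data -/

/-- A product `υ s`, bounded in modulus by `2`, that omits the value `2` at one point of the disc
omits it throughout, by the maximum principle. -/
theorem mul_fst_ne_two {υ : ℂ → ℂ} {h : ℂ → ℂ × ℂ} (hυ : DifferentiableOn ℂ υ disc)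
    (hυ1 : ∀ z ∈ disc, ‖υ z‖ ≤ 1) (hh : h ∈ HolGam) {w : ℂ} (hw : w ∈ disc)
    (hw2 : υ w * (h w).1 ≠ 2) {z : ℂ} (hz : z ∈ disc) : υ z * (h z).1 ≠ 2 := by
  intro hz2
  have hmax : IsMaxOn (norm ∘ fun x => υ x * (h x).1) disc z := by
    intro x hx
    simp only [Set.mem_ofPred_eq, Function.comp_apply, hz2, norm_mul, Complex.norm_ofNat]
    nlinarith [hυ1 x hx, norm_fst_le_two (hh.2 hx), norm_nonneg (υ x), norm_nonneg (h x).1]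
  have heq := Complex.eqOn_of_isPreconnected_of_isMaxOn_norm
    (convex_ball (0 : ℂ) 1).isPreconnected isOpen_disc (hυ.mul hh.1.fst) hz hmax hw
  exact hw2 (heq.trans hz2)

theorem differentiableOn_Phi {υ : ℂ → ℂ} {h : ℂ → ℂ × ℂ} (hυ : DifferentiableOn ℂ υ disc)
    (hh : DifferentiableOn ℂ h disc) (hne : ∀ z ∈ disc, υ z * (h z).1 ≠ 2) :
    DifferentiableOn ℂ (fun z => Phi (υ z) (h z)) disc :=
  ((((differentiableOn_const 2).mul hυ).mul hh.snd).sub hh.fst).div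
    ((differentiableOn_const 2).sub (hυ.mul hh.fst)) fun z hz => sub_ne_zero.2 (hne z hz).symm

theorem npSolvable_Phi {ν n : ℕ} (hn : 1 ≤ n) {h : ℂ → ℂ × ℂ} (hh : h ∈ HolGam)
    {l : Fin n → ℂ} (hlD : ∀ j, l j ∈ disc) {υ : ℂ → ℂ} (hυ : υ ∈ Bl ν)
    (hdef : PhiDefined υ l fun j => h (l j)) :
    NPSolvable l fun j => Phi (υ (l j)) (h (l j)) := by
  have hd := differentiableOn_of_mem_Bl hυ
  exact ⟨fun z => Phi (υ z) (h z),
    differentiableOn_Phi hd hh.1 fun z hz => mul_fst_ne_two hd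
      (fun x hx => norm_le_one_of_mem_Bl hυ hx) hh (hlD ⟨0, hn⟩) (hdef ⟨0, hn⟩) hz,
    fun x hx => norm_Phi_le_one (norm_le_one_of_mem_Bl hυ hx) (hh.2 hx), fun _ => rfl⟩

/-! ### Interpolation of a Blaschke product by a strict contraction -/

theorem exists_eq_prod_sub_mul {U : Set ℂ} (hU : IsOpen U) (t : Finset ℂ) (ht : ∀ c ∈ t, c ∈ U)
    {f : ℂ → ℂ} (hf : DifferentiableOn ℂ f U) (h0 : ∀ c ∈ t, f c = 0) :
    ∃ k : ℂ → ℂ, DifferentiableOn ℂ k U ∧ ∀ z, f z = (∏ c ∈ t, (z - c)) * k z := by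
  classical
  induction t using Finset.induction_on generalizing f with
  | empty => exact ⟨f, hf, by simp⟩
  | insert c t hc ih =>
    have hfc : ∀ z, f z = (z - c) * dslope f c z := fun z => by
      have := sub_smul_dslope f c z
      rw [h0 c (Finset.mem_insert_self c t), sub_zero, smul_eq_mul] at this
      exact this.symm
    obtain ⟨k, hk, hfk⟩ := ih (fun x hx => ht x (Finset.mem_insert_of_mem hx))
      ((Complex.differentiableOn_dslope
        (hU.mem_nhds (ht c (Finset.mem_insert_self c t)))).2 hf) fun x hx => by
        have hxc : x - c ≠ 0 := sub_ne_zero.2 fun e => hc (e ▸ hx)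
        have := hfc x
        rw [h0 x (Finset.mem_insert_of_mem hx)] at this
        exact (mul_eq_zero.1 this.symm).resolve_left hxc
    exact ⟨k, hk, fun z => by rw [hfc z, hfk z, Finset.prod_insert hc, mul_assoc]⟩

/-- On the unit circle `∏ (z - a_i) = z ^ d conj (∏ (1 - conj a_i z))`. -/
theorem prod_sub_eq_pow_mul_conj {d : ℕ} (a : Fin d → ℂ) {z : ℂ} (hz : ‖z‖ = 1) :
    ∏ i, (z - a i) = z ^ d * conj (∏ i, (1 - conj (a i) * z)) := by
  have hzz : z * conj z = 1 := by rw [Complex.mul_conj', hz]; norm_num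
  rw [map_prod, ← Fin.prod_const, ← Finset.prod_mul_distrib]
  refine Finset.prod_congr rfl fun i _ => ?_
  simp only [map_sub, map_mul, map_one, Complex.conj_conj]
  linear_combination a i * hzz

/-- The maximum principle applied to `exp (-F)`: a real part that is positive on a circle is
positive at the centre. -/
theorem re_pos_of_re_pos_on_sphere {F : ℂ → ℂ} {R : ℝ} (hR : 0 < R)
    (hF : DifferentiableOn ℂ F (Metric.closedBall 0 R))
    (hpos : ∀ z ∈ Metric.sphere (0 : ℂ) R, 0 < (F z).re) : 0 < (F 0).re := by
  have hcont : ContinuousOn (fun z => (F z).re) (Metric.sphere (0 : ℂ) R) :=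
    Complex.continuous_re.comp_continuousOn (hF.continuousOn.mono Metric.sphere_subset_closedBall)
  obtain ⟨w, hw, hmin⟩ := (isCompact_sphere (0 : ℂ) R).exists_isMinOn
    (NormedSpace.sphere_nonempty.2 hR.le) hcont
  have hd : DiffContOnCl ℂ (fun z => Complex.exp (-F z)) (Metric.ball 0 R) :=
    (hF.neg.cexp.mono (by rw [closure_ball _ hR.ne'])).diffContOnCl
  have hle := Complex.norm_le_of_forall_mem_frontier_norm_le (C := Real.exp (-(F w).re))
    Metric.isBounded_ball hd (fun z hz => by
      rw [frontier_ball _ hR.ne'] at hz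
      rw [Complex.norm_exp, Complex.neg_re]
      exact Real.exp_le_exp.2 (neg_le_neg (hmin hz)))
    (subset_closure (Metric.mem_ball_self hR))
  rw [Complex.norm_exp, Complex.neg_re, Real.exp_le_exp] at hle
  linarith [hpos w hw]

/-- If a continuous function is positive on the unit circle, then it is positive on some smaller
concentric circle. -/
theorem exists_radius_pos_on_sphere {u : ℂ → ℝ} (hu : Continuous u)
    (hpos : ∀ z : ℂ, ‖z‖ = 1 → 0 < u z) :
    ∃ R : ℝ, 0 < R ∧ R < 1 ∧ ∀ z ∈ Metric.sphere (0 : ℂ) R, 0 < u z := by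
  obtain ⟨δ, hδ, hsub⟩ := (isCompact_sphere (0 : ℂ) 1).exists_thickening_subset_open
    (isOpen_lt continuous_const hu) fun z hz => hpos z (mem_sphere_zero_iff_norm.1 hz)
  have hε : 0 < min (δ / 2) (1 / 2) := by positivity
  have hε1 : min (δ / 2) (1 / 2) ≤ 1 / 2 := min_le_right _ _
  have hε2 : min (δ / 2) (1 / 2) ≤ δ / 2 := min_le_left _ _
  refine ⟨1 - min (δ / 2) (1 / 2), by linarith, by linarith, fun z hz => hsub ?_⟩
  generalize min (δ / 2) (1 / 2) = ε at *
  rw [mem_sphere_zero_iff_norm] at hz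
  have hz0 : (‖z‖ : ℂ) ≠ 0 := by
    rw [hz, Complex.ofReal_ne_zero]
    linarith
  -- the radial projection of `z` to the unit circle is at distance `1 - |z|`
  refine Metric.mem_thickening_iff.2 ⟨z / ‖z‖, ?_, ?_⟩
  · rw [mem_sphere_zero_iff_norm, norm_div, Complex.norm_real, norm_norm]
    exact div_self (by exact_mod_cast hz0)
  · have : z - z / ‖z‖ = z / ‖z‖ * ((‖z‖ - 1 : ℝ) : ℂ) := by
      push_cast
      field_simp
    rw [dist_eq_norm, this, norm_mul, norm_div, Complex.norm_real, norm_norm,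
      div_self (by exact_mod_cast hz0), Complex.norm_real, hz, Real.norm_eq_abs, one_mul]
    rw [abs_of_neg (by linarith)]
    linarith

/-- A Blaschke product of degree `d` does not agree at more than `d` points with a holomorphic
function of supremum norm less than `1`. -/
theorem not_interpolate_blaschke {n d : ℕ} (hdn : d < n) {c : ℂ} (hc : ‖c‖ = 1) {a : Fin d → ℂ}
    (ha : ∀ i, a i ∈ disc) {l : Fin n → ℂ} (hl : Function.Injective l) (hlD : ∀ j, l j ∈ disc)
    {g : ℂ → ℂ} {r : ℝ} (hr : r < 1) (hg : DifferentiableOn ℂ g disc)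
    (hgr : ∀ z ∈ disc, ‖g z‖ ≤ r)
    (hgl : ∀ j, g (l j) = c * ∏ i, (l j - a i) / (1 - conj (a i) * l j)) : False := by
  classical
  set P : ℂ → ℂ := fun z => ∏ i, (z - a i) with hP
  set Q : ℂ → ℂ := fun z => ∏ i, (1 - conj (a i) * z) with hQ
  set L : ℂ → ℂ := fun z => ∏ j, (z - l j) with hL
  set M : ℂ → ℂ := fun z => ∏ j, (1 - conj (l j) * z) with hM
  have hQ0 : ∀ z, ‖z‖ ≤ 1 → Q z ≠ 0 := fun z hz =>
    Finset.prod_ne_zero_iff.2 fun i _ => one_sub_conj_mul_ne_zero (ha i) hz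
  have hM0 : ∀ z, ‖z‖ ≤ 1 → M z ≠ 0 := fun z hz =>
    Finset.prod_ne_zero_iff.2 fun j _ => one_sub_conj_mul_ne_zero (hlD j) hz
  have hPd : Differentiable ℂ P := by fun_prop
  have hQd : Differentiable ℂ Q := by fun_prop
  have hLd : Differentiable ℂ L := by fun_prop
  have hMd : Differentiable ℂ M := by fun_prop
  have hc0 : c ≠ 0 := norm_ne_zero_iff.1 (by rw [hc]; exact one_ne_zero)
  -- `c P - Q g` is `Q` times the difference of the two interpolants
  obtain ⟨k, hk, hfk⟩ := exists_eq_prod_sub_mul isOpen_disc (Finset.univ.image l)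
    (by simpa using hlD) (f := fun z => c * P z - Q z * g z)
    ((hPd.differentiableOn.const_mul c).sub (hQd.differentiableOn.mul hg)) (by
      simp only [Finset.mem_image, Finset.mem_univ, true_and, forall_exists_index,
        forall_apply_eq_imp_iff]
      intro j
      have := hQ0 (l j) (mem_disc_iff.1 (hlD j)).le
      rw [hgl j, Finset.prod_div_distrib]
      change c * P (l j) - Q (l j) * (c * (P (l j) / Q (l j))) = 0
      field_simp
      ring)
  replace hfk : ∀ z, c * P z - Q z * g z = L z * k z := fun z => by
    have := hfk z
    rwa [Finset.prod_image fun i _ j _ h => hl h] at this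
  -- Where this is positive, `L M ≠ 0` and `Re F > 0` for the function `F` defined below.
  obtain ⟨R, hR0, hR1, hpos⟩ := exists_radius_pos_on_sphere
    (u := fun z => (z ^ (n - d) * Q z * P z * conj (L z * M z)).re
      - r * ‖z ^ (n - d) * Q z ^ 2 * (L z * M z)‖)
    (by
      have := hPd.continuous
      have := hQd.continuous
      have := hLd.continuous
      have := hMd.continuous
      fun_prop)
    (fun z hz => by
      have hPz : P z = z ^ d * conj (Q z) := prod_sub_eq_pow_mul_conj a hz
      have hLz : L z = z ^ n * conj (M z) := prod_sub_eq_pow_mul_conj l hz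
      have hzz : z * conj z = 1 := by rw [Complex.mul_conj', hz]; norm_num
      have hpow : z ^ (n - d) * z ^ d = z ^ n := by rw [← pow_add, Nat.sub_add_cancel hdn.le]
      have hznn : z ^ n * conj z ^ n = 1 := by rw [← mul_pow, hzz, one_pow]
      have e1 : z ^ (n - d) * Q z * P z * conj (L z * M z)
          = ((‖Q z‖ ^ 2 * ‖M z‖ ^ 2 : ℝ) : ℂ) := by
        push_cast
        rw [← Complex.mul_conj', ← Complex.mul_conj', hPz, hLz]
        simp only [map_mul, map_pow, Complex.conj_conj]
        linear_combination (Q z * conj (Q z) * (M z * conj (M z)) * conj z ^ n) * hpow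
          + (Q z * conj (Q z) * (M z * conj (M z))) * hznn
      have e2 : ‖z ^ (n - d) * Q z ^ 2 * (L z * M z)‖ = ‖Q z‖ ^ 2 * ‖M z‖ ^ 2 := by
        rw [hLz]
        simp only [norm_mul, norm_pow, hz, one_pow, Complex.norm_conj]
        ring
      rw [e1, e2, Complex.ofReal_re]
      have h1 := norm_pos_iff.2 (hQ0 z hz.le)
      have h2 := norm_pos_iff.2 (hM0 z hz.le)
      have h3 : 0 < (1 - r) * (‖Q z‖ ^ 2 * ‖M z‖ ^ 2) :=
        mul_pos (sub_pos.2 hr) (by positivity)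
      linarith)
  have hsub : Metric.closedBall (0 : ℂ) R ⊆ disc := Metric.closedBall_subset_ball hR1
  set F : ℂ → ℂ := fun z => z ^ (n - d) * Q z * k z / (c * M z) with hF
  have hFd : DifferentiableOn ℂ F disc := by
    refine DifferentiableOn.div ?_ (hMd.differentiableOn.const_mul c) fun z hz =>
      mul_ne_zero hc0 (hM0 z (mem_disc_iff.1 hz).le)
    exact ((differentiableOn_id.pow _).mul hQd.differentiableOn).mul hk
  have hF0 : F 0 = 0 := by
    simp [hF, (Nat.sub_pos_of_lt hdn).ne']
  have := re_pos_of_re_pos_on_sphere hR0 (hFd.mono hsub) fun z hz => by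
    have hzD : z ∈ disc := hsub (Metric.sphere_subset_closedBall hz)
    have hu := hpos z hz
    have hLM : L z * M z ≠ 0 := fun h => by
      simp [h] at hu
    have hN : 0 < ‖L z * M z‖ ^ 2 := by positivity
    have hL0 : L z ≠ 0 := left_ne_zero_of_mul hLM
    have hMz : M z ≠ 0 := right_ne_zero_of_mul hLM
    have hkz : k z = (c * P z - Q z * g z) / L z := by
      rw [hfk z]
      field_simp
    have hconj : (L z * M z) * conj (L z * M z) = (‖L z * M z‖ : ℂ) ^ 2 := Complex.mul_conj' _
    have e : ((‖L z * M z‖ ^ 2 : ℝ) : ℂ) * F z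
        = z ^ (n - d) * Q z * P z * conj (L z * M z)
          - z ^ (n - d) * Q z ^ 2 * conj (L z * M z) * (g z / c) := by
      push_cast
      rw [← hconj]
      simp only [hF, hkz]
      generalize conj (L z * M z) = t
      field_simp
    have hre := congrArg Complex.re e
    rw [Complex.re_ofReal_mul, Complex.sub_re] at hre
    have hb : (z ^ (n - d) * Q z ^ 2 * conj (L z * M z) * (g z / c)).re
        ≤ r * ‖z ^ (n - d) * Q z ^ 2 * (L z * M z)‖ := by
      refine (Complex.re_le_norm _).trans ?_
      rw [norm_mul, norm_div, hc, div_one, norm_mul _ (conj _), Complex.norm_conj, ← norm_mul,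
        mul_comm]
      exact mul_le_mul_of_nonneg_right (hgr z hzD) (norm_nonneg _)
    exact pos_of_mul_pos_right (by linarith : 0 < ‖L z * M z‖ ^ 2 * (F z).re) hN.le
  rw [hF0] at this
  exact lt_irrefl _ this

/-! ### Extremality of the data taken from a map in `E ν n` -/

theorem mainTheorem8 (ν n : ℕ) (hn : 1 ≤ n) (h : ℂ → ℂ × ℂ) (hE : h ∈ SymBidisc.E ν n)
    (l : Fin n → ℂ) (hl : Function.Injective l) (hlD : ∀ j, l j ∈ SymBidisc.disc) :
    SymBidisc.IsGamData l (fun j => h (l j)) ∧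
      SymBidisc.CondCExtremally ν l (fun j => h (l j)) := by
  obtain ⟨hh, -, -, m, hm, hm2, d, hd, c, a, hc, ha, hB⟩ := hE
  have hdef : PhiDefined m l fun j => h (l j) := fun j => hm2 _ (hlD j)
  refine ⟨⟨hl, hlD, fun j => hh.2 (hlD j)⟩, fun υ hυ hυdef => npSolvable_Phi hn hh hlD hυ hυdef,
    m, hm, hdef, npSolvable_Phi hn hh hlD hm hdef, ?_⟩
  rintro ⟨g, r, hr, hg, hgr, hgl⟩
  exact not_interpolate_blaschke (by omega) hc ha hl hlD hr hg hgr
    fun j => (hgl j).trans (hB _ (hlD j))
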